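/- Let $\mathbb{S}^n$ be the space of real symmetric $n\times n$ matrices with inner product $\langle A,B\rangle=\mathrm{Tr}(AB)$ and Frobenius norm $\|\cdot\|_F$, and let $\lambda_i(A)$ be the $i$-th largest eigenvalue of $A\in\mathbb{S}^n$. For $1\le k<n$ let $$\mathcal{P}_{n,k}=\{QQ^\top : Q\in\mathbb{R}^{n\times k},\ Q^\top Q=I\},\qquad \mathcal{F}_{n,k}=\{X\in\mathbb{S}^n : 0\preceq X\preceq I,\ \mathrm{Tr}(X)=k\}$$ be the set of rank-$k$ projection matrices and the Fantope. There is a universal constant $c>0$ such that the following holds for all $1\le k<n$, all $\beta,\delta>0$, and all $f$. Let $f:\mathbb{S}^n\to\mathbb{R}$ be convex and $\beta$-smooth, i.e. differentiable with $\|\nabla f(X)-\nabla f(Y)\|_F\le\beta\|X-Y\|_F$ for all $X,Y\in\mathbb{S}^n$. Let $X^*$ be a minimizer of $f$ over $\mathcal{F}_{n,k}$ that satisfies the eigengap assumption with parameter $\delta$: $$\lambda_{n-k}(\nabla f(X^*))-\lambda_{n-k+1}(\nabla f(X^*))\ge\delta .$$ Let $(X_t)_{t\ge1}$ be generated by nonconvex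 projected gradient descent with step-size $1/\beta$: $X_1\in\mathcal{F}_{n,k}$ satisfies $\|X_1-X^*\|_F\le\frac{\delta}{4\beta}$, and for every $t\ge1$ the matrix $X_{t+1}$ is a (any) point of $\mathcal{P}_{n,k}$ nearest in Frobenius norm to $W_t:=X_t-\frac1\beta\nabla f(X_t)$. Then for all $t\ge1$: 1. $\mathrm{rank}(X_{t+1})=k$, and $X_{t+1}$ is the Euclidean projection of $W_t$ onto the Fantope $\mathcal{F}_{n,k}$, so that the iterates coincide with those of projected gradient descent over $\mathcal{F}_{n,k}$ started at $X_1$. Moreover $X_{t+1}$ is the unique point of $\mathcal{P}_{n,k}$ nearest to $W_t$, and it is obtained from a rank-$k$ spectral decomposition of $W_t$: $X_{t+1}=QQ^\top$ for every $Q\in\mathbb{R}^{n\times k}$ whose columns are orthonormal eigenvectors of $W_t$ for its $k$ largest eigenvalues. 2. $f(X_t)-f(X^*)\le\big(f(X_1)-f(X^*)\big)\exp\big(-c\,\min\{\delta/\beta,1\}\,(t-1)\big)$. -/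

import Mathlib

open Filter Topology Asymptotics
open scoped Matrix Matrix.Norms.Frobenius

/-- The space of real symmetric `n × n` matrices. The norm on matrices is the Frobenius norm. -/
def symSpace (n : ℕ) : Set (Matrix (Fin n) (Fin n) ℝ) :=
  {X | X.IsHermitian}

/-- The set of rank-`k` orthogonal projection matrices `Q Qᵀ` with `Qᵀ Q = I`, `Q` of size
`n × k`. -/
def projMatrices (n k : ℕ) : Set (Matrix (Fin n) (Fin n) ℝ) :=
  {X | ∃ Q : Matrix (Fin n) (Fin k) ℝ, Qᵀ * Q = 1 ∧ X = Q * Qᵀ}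

/-- The Fantope: symmetric matrices `X` with `0 ⪯ X ⪯ I` and trace `k`. -/
def fantope (n k : ℕ) : Set (Matrix (Fin n) (Fin n) ℝ) :=
  {X | X.PosSemidef ∧ (1 - X).PosSemidef ∧ X.trace = k}

/-- `λ_i(A)`: the `i`-th largest eigenvalue, counted with multiplicity and from `i = 1`, of a
symmetric matrix `A` (and `0` if `A` is not symmetric or `i` is not in `{1, …, n}`). -/
noncomputable def nthEig {n : ℕ} (A : Matrix (Fin n) (Fin n) ℝ) (i : ℕ) : ℝ :=
  open Classical in
  if h : A.IsHermitian ∧ 1 ≤ i ∧ i ≤ n then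
    h.1.eigenvalues₀ ⟨i - 1, by rw [Fintype.card_fin]; omega⟩
  else 0

/-- `G` is the gradient at `X` of `f`, as a function on the space of symmetric matrices with the
inner product `⟨A, B⟩ = Tr(A B)`. -/
def IsSymGradient {n : ℕ} (f : Matrix (Fin n) (Fin n) ℝ → ℝ)
    (G X : Matrix (Fin n) (Fin n) ℝ) : Prop :=
  G ∈ symSpace n ∧
    (fun Y => f Y - f X - (G * (Y - X)).trace) =o[𝓝[symSpace n] X] (fun Y => Y - X)

/-- `f` is convex and `β`-smooth on the space of symmetric matrices, with gradient map `grad`. -/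
structure IsConvexSmooth {n : ℕ} (f : Matrix (Fin n) (Fin n) ℝ → ℝ)
    (grad : Matrix (Fin n) (Fin n) ℝ → Matrix (Fin n) (Fin n) ℝ) (β : ℝ) : Prop where
  convex : ConvexOn ℝ (symSpace n) f
  gradient : ∀ X ∈ symSpace n, IsSymGradient f (grad X) X
  lipschitz : ∀ X ∈ symSpace n, ∀ Y ∈ symSpace n, ‖grad X - grad Y‖ ≤ β * ‖X - Y‖

/-- `Y` is a Euclidean (Frobenius) projection of `W` onto the set `S`: a nearest point of `S`.
It need not be unique if `S` is not convex. -/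
def IsEuclProj {n : ℕ} (S : Set (Matrix (Fin n) (Fin n) ℝ))
    (W Y : Matrix (Fin n) (Fin n) ℝ) : Prop :=
  Y ∈ S ∧ ∀ Z ∈ S, ‖Y - W‖ ≤ ‖Z - W‖

/-- `(X_t)_{t ≥ 1}` is generated by projected gradient steps onto the set `S` with fixed
step-size `η` (any nearest point of `S` may be chosen in each step). -/
def IsPGD {n : ℕ} (S : Set (Matrix (Fin n) (Fin n) ℝ))
    (grad : Matrix (Fin n) (Fin n) ℝ → Matrix (Fin n) (Fin n) ℝ) (η : ℝ)
    (X : ℕ → Matrix (Fin n) (Fin n) ℝ) : Prop :=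
  ∀ t, 1 ≤ t → IsEuclProj S (X t - η • grad (X t)) (X (t + 1))

/-- `P = Q Qᵀ` for every `Q` whose orthonormal columns are eigenvectors of `W` for its `k` largest
eigenvalues: `P` is what any rank-`k` (leading) spectral decomposition of `W` yields. -/
def IsTopProjection {n : ℕ} (k : ℕ) (W P : Matrix (Fin n) (Fin n) ℝ) : Prop :=
  ∀ Q : Matrix (Fin n) (Fin k) ℝ, Qᵀ * Q = 1 →
    W * Q = Q * Matrix.diagonal (fun i : Fin k => nthEig W ((i : ℕ) + 1)) → P = Q * Qᵀ

/-! A Ky Fan inequality with a gap drives both halves: if `P` is the top eigenprojection of a matrix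
with eigengap `g`, replacing `P` by `Z` in the Fantope loses at least `g * (k - tr(PZ))`, and `k -
tr(PZ)` dominates `‖P - Z‖² / 2` (`gap_mul_trace_le`, `norm_sub_sq_le_of_mem_fantope`). Applied to
`-∇f(X*)`, it makes `X*` the bottom eigenprojection of `∇f(X*)` and gives quadratic growth with
constant `δ/2`. Hence `X* - ∇f(X*)/β` has eigengap at least `1 + δ/β`. The gradient step is
2-Lipschitz, so within distance `δ/(4β)` of `X*` Weyl's inequality leaves `W_t` a gap of at least 1
(`one_le_eigengap`). Gap 1 is what makes the top eigenprojection the Fantope projection, with a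
Pythagorean inequality that gives uniqueness (`norm_sub_sq_add_le`). The same inequality keeps the
iterates in the ball (`norm_sub_le_of_gradStep`), and quadratic growth gives the rate
(`sub_le_of_gradStep`). -/

/-- The orthogonal projection onto the span of the columns of `U` indexed by `s`. -/
noncomputable def colProj {n : ℕ} (U : Matrix (Fin n) (Fin n) ℝ) (s : Finset (Fin n)) :
    Matrix (Fin n) (Fin n) ℝ :=
  U * Matrix.diagonal (fun i => if i ∈ s then 1 else 0) * Uᵀ

/-! ### Frobenius geometry of symmetric matrices. -/

theorem frobenius_norm_sq {n : ℕ} (A : Matrix (Fin n) (Fin n) ℝ) :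
    ‖A‖ ^ 2 = ∑ i, ∑ j, A i j ^ 2 := by
  rw [Matrix.frobenius_norm_def, ← Real.sqrt_eq_rpow, Real.sq_sqrt]
  · simp
  · positivity

theorem frobenius_norm_sq_eq_trace {n : ℕ} {A : Matrix (Fin n) (Fin n) ℝ} (hA : A ∈ symSpace n) :
    ‖A‖ ^ 2 = (A * A).trace := by
  have h : Aᵀ = A := hA
  rw [frobenius_norm_sq]
  nth_rewrite 3 [← h]
  simp [Matrix.trace, Matrix.mul_apply, sq]

theorem abs_trace_mul_le {n : ℕ} {A : Matrix (Fin n) (Fin n) ℝ} (B : Matrix (Fin n) (Fin n) ℝ)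
    (hA : A ∈ symSpace n) : |(A * B).trace| ≤ ‖A‖ * ‖B‖ := by
  have h : Aᵀ = A := hA
  apply abs_le_of_sq_le_sq _ (by positivity)
  have e : (A * B).trace = ∑ j, ∑ i, A i j * B i j := by
    nth_rewrite 1 [← h]
    simp [Matrix.trace, Matrix.mul_apply]
  rw [e, Finset.sum_comm, mul_pow, frobenius_norm_sq, frobenius_norm_sq]
  simp only [← Finset.sum_product', Finset.univ_product_univ]
  exact Finset.sum_mul_sq_le_sq_mul_sq Finset.univ (fun x : Fin n × Fin n => A x.1 x.2)
    (fun x => B x.1 x.2)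

theorem symSpace_sub {n : ℕ} {A B : Matrix (Fin n) (Fin n) ℝ} (hA : A ∈ symSpace n)
    (hB : B ∈ symSpace n) : A - B ∈ symSpace n :=
  Matrix.IsHermitian.sub hA hB

theorem symSpace_smul {n : ℕ} {A : Matrix (Fin n) (Fin n) ℝ} (r : ℝ) (hA : A ∈ symSpace n) :
    r • A ∈ symSpace n :=
  Matrix.IsHermitian.smul hA (IsSelfAdjoint.all r)

theorem symSpace_add {n : ℕ} {A B : Matrix (Fin n) (Fin n) ℝ} (hA : A ∈ symSpace n)
    (hB : B ∈ symSpace n) : A + B ∈ symSpace n :=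
  Matrix.IsHermitian.add hA hB

/-! ### The Fantope and its projection matrices. -/

theorem fantope_subset_symSpace {n k : ℕ} : fantope n k ⊆ symSpace n := fun _ h => h.1.1

theorem convex_fantope {n k : ℕ} : Convex ℝ (fantope n k) := by
  intro A hA B hB a b ha hb hab
  refine ⟨(hA.1.smul ha).add (hB.1.smul hb), ?_, ?_⟩
  · have := (hA.2.1.smul ha).add (hB.2.1.smul hb)
    convert this using 1
    rw [smul_sub, smul_sub, sub_add_sub_comm, ← add_smul, hab, one_smul]
  · rw [Matrix.trace_add, Matrix.trace_smul, Matrix.trace_smul, hA.2.2, hB.2.2, ← add_smul, hab,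
      one_smul]

/-- `Z - Z²` is the sum of the positive semidefinite matrices `Z(1 - Z)Z` and `(1 - Z)Z(1 - Z)`. -/
theorem trace_sq_le_of_mem_fantope {n k : ℕ} {Z : Matrix (Fin n) (Fin n) ℝ}
    (hZ : Z ∈ fantope n k) : (Z * Z).trace ≤ k := by
  obtain ⟨h0, h1, h2⟩ := hZ
  have a := (h1.conjTranspose_mul_mul_same Z).trace_nonneg
  have b := (h0.conjTranspose_mul_mul_same (1 - Z)).trace_nonneg
  rw [h0.1.eq] at a
  rw [h1.1.eq] at b
  have : Z * (1 - Z) * Z + (1 - Z) * Z * (1 - Z) = Z - Z * Z := by noncomm_ring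
  have e := congrArg Matrix.trace this
  rw [Matrix.trace_add, Matrix.trace_sub, h2] at e
  linarith

theorem mem_fantope_of_idempotent {n k : ℕ} {P : Matrix (Fin n) (Fin n) ℝ}
    (hs : Pᵀ = P) (hP : P * P = P) (ht : P.trace = k) : P ∈ fantope n k := by
  refine ⟨?_, ?_, ht⟩
  · have := Matrix.posSemidef_conjTranspose_mul_self P
    rwa [Matrix.conjTranspose_eq_transpose_of_trivial, hs, hP] at this
  · have := Matrix.posSemidef_conjTranspose_mul_self (1 - P)
    rwa [Matrix.conjTranspose_eq_transpose_of_trivial, Matrix.transpose_sub,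
      Matrix.transpose_one, hs, mul_sub, sub_mul, sub_mul, hP, mul_one, one_mul, mul_one, sub_self,
      sub_zero] at this

theorem projMatrices_subset_fantope {n k : ℕ} : projMatrices n k ⊆ fantope n k := by
  rintro _ ⟨Q, hQ, rfl⟩
  apply mem_fantope_of_idempotent
  · simp
  · rw [Matrix.mul_assoc, ← Matrix.mul_assoc Qᵀ, hQ, Matrix.one_mul]
  · rw [Matrix.trace_mul_comm, hQ]; simp

theorem rank_of_mem_projMatrices {n k : ℕ} {P : Matrix (Fin n) (Fin n) ℝ}
    (hP : P ∈ projMatrices n k) : P.rank = k := by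
  obtain ⟨Q, hQ, rfl⟩ := hP
  rw [Matrix.rank_self_mul_transpose, ← Matrix.rank_transpose_mul_self, hQ]
  simp

/-! ### Spectral projections and the Ky Fan inequality. -/

section colProj

variable {n : ℕ} {U : Matrix (Fin n) (Fin n) ℝ} (hU : Uᵀ * U = 1) (s : Finset (Fin n))
include hU

theorem colProj_mul_self : colProj U s * colProj U s = colProj U s := by
  have : ∀ D E : Matrix (Fin n) (Fin n) ℝ, U * D * Uᵀ * (U * E * Uᵀ) = U * (D * E) * Uᵀ := by
    intro D E
    calc _ = U * D * (Uᵀ * U) * E * Uᵀ := by noncomm_ring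
      _ = _ := by rw [hU]; noncomm_ring
  rw [colProj, this, Matrix.diagonal_mul_diagonal]
  simp only [mul_ite, mul_one, mul_zero]
  congr! 4 with i
  split_ifs <;> rfl

theorem colProj_mem_fantope {k : ℕ} (hs : s.card = k) : colProj U s ∈ fantope n k := by
  subst hs
  refine mem_fantope_of_idempotent ?_ (colProj_mul_self hU s) ?_
  · simp [colProj, Matrix.mul_assoc]
  · rw [colProj, Matrix.trace_mul_comm, ← Matrix.mul_assoc, hU, one_mul, Matrix.trace_diagonal]
    simp

/-- The quantitative Ky Fan inequality. -/
theorem gap_mul_trace_le {d : Fin n → ℝ} {a b : ℝ}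
    (ha : ∀ i ∈ s, a ≤ d i) (hb : ∀ i ∉ s, d i ≤ b) {k : ℕ} (hs : s.card = k)
    {Z : Matrix (Fin n) (Fin n) ℝ} (hZ : Z ∈ fantope n k) :
    (a - b) * (k - (colProj U s * Z).trace) ≤
      (U * Matrix.diagonal d * Uᵀ * (colProj U s - Z)).trace := by
  subst hs
  have key : ∀ (e : Fin n → ℝ) (Y : Matrix (Fin n) (Fin n) ℝ),
      (U * Matrix.diagonal e * Uᵀ * Y).trace = ∑ i, e i * (Uᵀ * Y * U) i i := by
    intro e Y
    rw [Matrix.mul_assoc, Matrix.mul_assoc, Matrix.trace_mul_comm, Matrix.mul_assoc]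
    simp [Matrix.trace, Matrix.diagonal_mul]
  have h0 : ∀ i, 0 ≤ (Uᵀ * Z * U) i i := fun i => by
    simpa using (hZ.1.conjTranspose_mul_mul_same U).diag_nonneg (i := i)
  have h1 : ∀ i, (Uᵀ * Z * U) i i ≤ 1 := fun i => by
    have := (hZ.2.1.conjTranspose_mul_mul_same U).diag_nonneg (i := i)
    rw [Matrix.conjTranspose_eq_transpose_of_trivial, mul_sub, mul_one, sub_mul, hU] at this
    simpa using this
  have hsum : ∑ i, (Uᵀ * Z * U) i i = s.card := by
    have : (Uᵀ * Z * U).trace = s.card := by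
      rw [Matrix.trace_mul_comm, ← Matrix.mul_assoc, mul_eq_one_comm.mp hU, one_mul, hZ.2.2]
    simpa [Matrix.trace] using this
  have hP : ∀ i, (Uᵀ * colProj U s * U) i i = if i ∈ s then 1 else 0 := by
    intro i
    have : Uᵀ * colProj U s * U = (Uᵀ * U) * Matrix.diagonal (fun i => if i ∈ s then 1 else 0) *
        (Uᵀ * U) := by rw [colProj]; noncomm_ring
    rw [this, hU]; simp
  have hc : (s.card : ℝ) = ∑ i, if i ∈ s then (1 : ℝ) else 0 := by simp
  have hPZ : (colProj U s * Z).trace = ∑ i, (if i ∈ s then 1 else 0) * (Uᵀ * Z * U) i i := key _ Z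
  rw [hPZ, Matrix.mul_sub, Matrix.trace_sub, key, key, ← Finset.sum_sub_distrib]
  simp only [hP]
  -- Both traces equal `k`, so `b` times their difference can be added for free; the inequality then
  -- holds term by term.
  have e1 : b * ∑ i, ((if i ∈ s then (1 : ℝ) else 0) - (Uᵀ * Z * U) i i) = 0 := by
    rw [Finset.sum_sub_distrib, hsum, ← hc, sub_self, mul_zero]
  rw [hc, ← Finset.sum_sub_distrib]
  refine (le_of_eq ((add_zero _).symm.trans (congrArg _ e1.symm))).trans ?_
  rw [Finset.mul_sum, Finset.mul_sum, ← Finset.sum_add_distrib]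
  refine Finset.sum_le_sum fun i _ => ?_
  by_cases hi : i ∈ s
  · simp only [hi, if_true]
    nlinarith [ha i hi, h1 i]
  · simp only [hi, if_false]
    nlinarith [hb i hi, h0 i]

end colProj

/-- Expand the square: `tr(P²)` and `tr(Z²)` are both at most `k`. This converts the trace deficit
into a distance. -/
theorem norm_sub_sq_le_of_mem_fantope {n k : ℕ} {P Z : Matrix (Fin n) (Fin n) ℝ}
    (hP : P ∈ fantope n k) (hZ : Z ∈ fantope n k) :
    ‖P - Z‖ ^ 2 ≤ 2 * (k - (P * Z).trace) := by
  rw [frobenius_norm_sq_eq_trace (symSpace_sub hP.1.1 hZ.1.1)]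
  have h1 := trace_sq_le_of_mem_fantope hP
  have h2 := trace_sq_le_of_mem_fantope hZ
  rw [sub_mul, mul_sub, mul_sub, Matrix.trace_sub, Matrix.trace_sub, Matrix.trace_sub,
    Matrix.trace_mul_comm Z P]
  linarith

/-! ### Ordered eigenvalues and Weyl's inequality. -/

/-- The spectral theorem with the eigenvalues in decreasing order. -/
theorem exists_spectral_decomposition {n : ℕ} {A : Matrix (Fin n) (Fin n) ℝ}
    (hA : A ∈ symSpace n) : ∃ U : Matrix (Fin n) (Fin n) ℝ, Uᵀ * U = 1 ∧
      A = U * Matrix.diagonal (fun i : Fin n => nthEig A (i + 1)) * Uᵀ := by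
  have hA' : A.IsHermitian := hA
  -- `eigenvalues` is `eigenvalues₀` reindexed by an arbitrary bijection, which `e` undoes.
  let e : Fin n ≃ Fin n :=
    (finCongr (Fintype.card_fin n)).symm.trans (Fintype.equivOfCardEq (Fintype.card_fin _))
  let V : Matrix (Fin n) (Fin n) ℝ := hA'.eigenvectorUnitary
  have hV : Vᵀ * V = 1 := by
    have := Unitary.coe_star_mul_self hA'.eigenvectorUnitary
    rwa [Matrix.star_eq_conjTranspose, Matrix.conjTranspose_eq_transpose_of_trivial] at this
  have hd : (fun i : Fin n => nthEig A (i + 1)) = hA'.eigenvalues ∘ e := by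
    funext i
    have : A.IsHermitian ∧ 1 ≤ (i : ℕ) + 1 ∧ (i : ℕ) + 1 ≤ n := ⟨hA', by omega, by omega⟩
    rw [nthEig, dif_pos this]
    simp [Matrix.IsHermitian.eigenvalues, e, finCongr]
    rfl
  refine ⟨V.submatrix id e, ?_, ?_⟩
  · rw [Matrix.transpose_submatrix, ← Matrix.submatrix_mul Vᵀ V e id e Function.bijective_id, hV]
    simp
  · rw [hd, ← Matrix.submatrix_diagonal_equiv, Matrix.transpose_submatrix,
      Matrix.submatrix_mul_equiv, Matrix.submatrix_mul_equiv]
    have := hA'.spectral_theorem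
    rw [Unitary.conjStarAlgAut_apply] at this
    simpa [V, Matrix.star_eq_conjTranspose] using this

theorem nthEig_antitone {n : ℕ} {A : Matrix (Fin n) (Fin n) ℝ} (hA : A ∈ symSpace n) {i j : ℕ}
    (hi : 1 ≤ i) (hij : i ≤ j) (hj : j ≤ n) : nthEig A j ≤ nthEig A i := by
  have hA' : A.IsHermitian := hA
  rw [nthEig, nthEig, dif_pos ⟨hA', by omega, by omega⟩, dif_pos ⟨hA', by omega, by omega⟩]
  apply hA'.eigenvalues₀_antitone
  rw [Fin.mk_le_mk]
  omega

/-- A form of Weyl's inequality: if `M` has more eigenvalues `≥ a` than `B` has eigenvalues `> b`,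
then `a ≤ b + ‖M - B‖`. -/
theorem le_add_norm_of_card_lt {n : ℕ} {U V : Matrix (Fin n) (Fin n) ℝ} (hU : Uᵀ * U = 1)
    (hV : Vᵀ * V = 1) {d μ : Fin n → ℝ} {s r : Finset (Fin n)} (hrs : r.card < s.card) {a b : ℝ}
    (ha : ∀ i ∈ s, a ≤ d i) (hb : ∀ i ∉ r, μ i ≤ b) :
    a ≤ b + ‖U * Matrix.diagonal d * Uᵀ - V * Matrix.diagonal μ * Vᵀ‖ := by
  classical
  -- The kernel consists of the vectors in the span of the `s`-columns of `U` that are orthogonal to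
  -- the `r`-columns of `V`; it is nonzero by dimension count.
  let L : (Fin n → ℝ) →ₗ[ℝ] ({i // i ∉ s} → ℝ) × ({i // i ∈ r} → ℝ) :=
    LinearMap.prod
      (LinearMap.funLeft ℝ ℝ Subtype.val ∘ₗ Uᵀ.mulVecLin)
      (LinearMap.funLeft ℝ ℝ Subtype.val ∘ₗ Vᵀ.mulVecLin)
  have hker : LinearMap.ker L ≠ ⊥ := by
    apply LinearMap.ker_ne_bot_of_finrank_lt
    rw [Module.finrank_prod, Module.finrank_pi, Module.finrank_pi, Module.finrank_pi,
      Fintype.card_subtype_compl]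
    simp only [Fintype.card_fin, Fintype.card_coe]
    have := s.card_le_univ
    rw [Fintype.card_fin] at this
    omega
  obtain ⟨x, hx, hx0⟩ := Submodule.exists_mem_ne_zero_of_ne_bot hker
  rw [LinearMap.mem_ker] at hx
  have hxU : ∀ i ∉ s, (Uᵀ *ᵥ x) i = 0 := fun i hi => congrFun (congrArg Prod.fst hx) ⟨i, hi⟩
  have hxV : ∀ i ∈ r, (Vᵀ *ᵥ x) i = 0 := fun i hi => congrFun (congrArg Prod.snd hx) ⟨i, hi⟩
  have hpos : 0 < x ⬝ᵥ x := by
    refine lt_of_le_of_ne (Finset.sum_nonneg fun i _ => mul_self_nonneg _) fun h => ?_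
    exact hx0 (dotProduct_self_eq_zero.mp h.symm)
  have quad : ∀ (T : Matrix (Fin n) (Fin n) ℝ) (e : Fin n → ℝ),
      x ⬝ᵥ ((T * Matrix.diagonal e * Tᵀ) *ᵥ x) = ∑ i, e i * (Tᵀ *ᵥ x) i ^ 2 := by
    intro T e
    rw [← Matrix.mulVec_mulVec, ← Matrix.mulVec_mulVec, Matrix.dotProduct_mulVec,
      ← Matrix.mulVec_transpose, dotProduct]
    refine Finset.sum_congr rfl fun i _ => ?_
    rw [Matrix.mulVec_diagonal]; ring
  have one : ∀ T : Matrix (Fin n) (Fin n) ℝ, Tᵀ * T = 1 → ∑ i, (Tᵀ *ᵥ x) i ^ 2 = x ⬝ᵥ x := by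
    intro T hT
    have := quad T 1
    have h1 : Matrix.diagonal (1 : Fin n → ℝ) = 1 := Matrix.diagonal_one
    rw [h1, mul_one, mul_eq_one_comm.mp hT, Matrix.one_mulVec] at this
    simpa using this.symm
  have hM : a * (x ⬝ᵥ x) ≤ x ⬝ᵥ ((U * Matrix.diagonal d * Uᵀ) *ᵥ x) := by
    rw [quad, ← one U hU, Finset.mul_sum]
    refine Finset.sum_le_sum fun i _ => ?_
    by_cases hi : i ∈ s
    · exact mul_le_mul_of_nonneg_right (ha i hi) (sq_nonneg _)
    · simp [hxU i hi]
  have hB : x ⬝ᵥ ((V * Matrix.diagonal μ * Vᵀ) *ᵥ x) ≤ b * (x ⬝ᵥ x) := by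
    rw [quad, ← one V hV, Finset.mul_sum]
    refine Finset.sum_le_sum fun i _ => ?_
    by_cases hi : i ∈ r
    · simp [hxV i hi]
    · exact mul_le_mul_of_nonneg_right (hb i hi) (sq_nonneg _)
  set E := U * Matrix.diagonal d * Uᵀ - V * Matrix.diagonal μ * Vᵀ with hE
  have hEs : E ∈ symSpace n := by
    refine symSpace_sub ?_ ?_ <;> change Matrix.conjTranspose _ = _ <;>
      simp [Matrix.mul_assoc]
  -- Testing against the rank-one matrix `x xᵀ` bounds the quadratic form by the Frobenius norm
  -- through Cauchy–Schwarz.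
  have hxx : ‖Matrix.vecMulVec x x‖ = x ⬝ᵥ x := by
    rw [← sq_eq_sq₀ (norm_nonneg _) hpos.le, frobenius_norm_sq, sq, dotProduct,
      Finset.sum_mul_sum]
    refine Finset.sum_congr rfl fun i _ => Finset.sum_congr rfl fun j _ => ?_
    rw [Matrix.vecMulVec_apply]; ring
  have hEx : x ⬝ᵥ (E *ᵥ x) ≤ ‖E‖ * (x ⬝ᵥ x) := by
    have := (le_abs_self _).trans (abs_trace_mul_le (Matrix.vecMulVec x x) hEs)
    rwa [hxx, Matrix.mul_vecMulVec, Matrix.trace_vecMulVec, dotProduct_comm] at this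
  have hsplit : x ⬝ᵥ (E *ᵥ x) = x ⬝ᵥ ((U * Matrix.diagonal d * Uᵀ) *ᵥ x) -
      x ⬝ᵥ ((V * Matrix.diagonal μ * Vᵀ) *ᵥ x) := by
    rw [hE, Matrix.sub_mulVec, dotProduct_sub]
  nlinarith

/-! ### Convex smooth functions, by restriction to lines. -/

section smooth

variable {n : ℕ} {f : Matrix (Fin n) (Fin n) ℝ → ℝ}
  {grad : Matrix (Fin n) (Fin n) ℝ → Matrix (Fin n) (Fin n) ℝ} {β : ℝ}
  {X Y : Matrix (Fin n) (Fin n) ℝ}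

theorem IsSymGradient.hasDerivAt_line {G D : Matrix (Fin n) (Fin n) ℝ} {s : ℝ}
    (hX : X ∈ symSpace n) (hD : D ∈ symSpace n) (h : IsSymGradient f G (X + s • D)) :
    HasDerivAt (fun r : ℝ => f (X + r • D)) (G * D).trace s := by
  rw [hasDerivAt_iff_isLittleO]
  have ht : Tendsto (fun r : ℝ => X + r • D) (𝓝 s) (𝓝[symSpace n] (X + s • D)) := by
    refine tendsto_nhdsWithin_iff.mpr ⟨?_, .of_forall fun r => symSpace_add hX (symSpace_smul r hD)⟩
    exact (Continuous.tendsto (by fun_prop) s)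
  have h2 := h.2.comp_tendsto ht
  have e : ∀ r : ℝ, X + r • D - (X + s • D) = (r - s) • D := fun r => by module
  have h3 : ((fun Z : Matrix (Fin n) (Fin n) ℝ => Z - (X + s • D)) ∘ fun r : ℝ => X + r • D)
      =O[𝓝 s] fun r => r - s := by
    refine IsBigO.of_bound ‖D‖ (.of_forall fun r => ?_)
    rw [Function.comp_apply, e, norm_smul, mul_comm]
  refine (h2.trans_isBigO h3).congr_left fun r => ?_
  simp only [Function.comp_apply, e, Matrix.mul_smul, Matrix.trace_smul]

variable (hf : IsConvexSmooth f grad β)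
include hf

theorem IsConvexSmooth.le_of_convex (hX : X ∈ symSpace n) (hY : Y ∈ symSpace n) :
    f X + (grad X * (Y - X)).trace ≤ f Y := by
  have hD := symSpace_sub hY hX
  have hderiv : HasDerivAt (fun r : ℝ => f (X + r • (Y - X))) (grad X * (Y - X)).trace 0 := by
    apply IsSymGradient.hasDerivAt_line hX hD
    rw [zero_smul, add_zero]
    exact hf.gradient X hX
  have hconv : ConvexOn ℝ Set.univ (fun r : ℝ => f (X + r • (Y - X))) := by
    refine ⟨convex_univ, fun r _ s _ a b ha hb hab => ?_⟩
    have := hf.convex.2 (symSpace_add hX (symSpace_smul r hD))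
      (symSpace_add hX (symSpace_smul s hD)) ha hb hab
    refine le_trans (le_of_eq ?_) this
    beta_reduce
    congr 1
    obtain rfl : b = 1 - a := by linarith
    simp only [smul_eq_mul]
    module
  have := hconv.le_slope_of_hasDerivAt (Set.mem_univ _) (Set.mem_univ _) zero_lt_one hderiv
  simp only [slope_def_field, one_smul, zero_smul, add_zero, add_sub_cancel, sub_zero,
    div_one] at this
  linarith

/-- Along the segment, `f` minus its quadratic upper model has nonpositive derivative, because the
gradient is `β`-Lipschitz. -/
theorem IsConvexSmooth.descent (hX : X ∈ symSpace n) (hY : Y ∈ symSpace n) :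
    f Y ≤ f X + (grad X * (Y - X)).trace + β / 2 * ‖Y - X‖ ^ 2 := by
  have hD := symSpace_sub hY hX
  have hs : ∀ s : ℝ, X + s • (Y - X) ∈ symSpace n := fun s => symSpace_add hX (symSpace_smul s hD)
  have hderiv : ∀ s : ℝ, HasDerivAt
      (fun r : ℝ => f (X + r • (Y - X)) - r * (grad X * (Y - X)).trace
        - r ^ 2 * (β / 2 * ‖Y - X‖ ^ 2))
      ((grad (X + s • (Y - X)) * (Y - X)).trace - 1 * (grad X * (Y - X)).trace
        - (2 : ℕ) * s ^ (2 - 1) * (β / 2 * ‖Y - X‖ ^ 2)) s := fun s =>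
    ((IsSymGradient.hasDerivAt_line hX hD (hf.gradient _ (hs s))).sub
      ((hasDerivAt_id' s).mul_const _)).sub ((hasDerivAt_pow 2 s).mul_const _)
  have hanti := antitoneOn_of_deriv_nonpos (convex_Icc (0 : ℝ) 1)
    (fun s _ => (hderiv s).continuousAt.continuousWithinAt)
    (fun s _ => (hderiv s).differentiableAt.differentiableWithinAt) (by
      intro s hs'
      rw [interior_Icc] at hs'
      rw [(hderiv s).deriv]
      have h1 := abs_trace_mul_le (Y - X)
        (symSpace_sub (hf.gradient _ (hs s)).1 (hf.gradient _ hX).1)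
      have h2 := hf.lipschitz _ (hs s) _ hX
      rw [add_sub_cancel_left, norm_smul, Real.norm_of_nonneg hs'.1.le] at h2
      have h3 := (le_abs_self _).trans h1
      rw [Matrix.sub_mul, Matrix.trace_sub] at h3
      have h4 := mul_le_mul_of_nonneg_right h2 (norm_nonneg (Y - X))
      push_cast
      simp only [pow_one]
      nlinarith)
  have := hanti (Set.left_mem_Icc.mpr zero_le_one) (Set.right_mem_Icc.mpr zero_le_one) zero_le_one
  simp only [one_smul, zero_smul, add_zero, add_sub_cancel] at this
  linarith

/-- The first-order optimality condition. -/
theorem IsConvexSmooth.trace_grad_mul_nonneg {S : Set (Matrix (Fin n) (Fin n) ℝ)}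
    (hS : Convex ℝ S) (hSs : S ⊆ symSpace n) (hX : X ∈ S) (hmin : ∀ Z ∈ S, f X ≤ f Z)
    (hY : Y ∈ S) : 0 ≤ (grad X * (Y - X)).trace := by
  have hD := symSpace_sub (hSs hY) (hSs hX)
  have hderiv : HasDerivAt (fun r : ℝ => f (X + r • (Y - X))) (grad X * (Y - X)).trace 0 := by
    apply IsSymGradient.hasDerivAt_line (hSs hX) hD
    rw [zero_smul, add_zero]
    exact hf.gradient X (hSs hX)
  have hlim := (hasDerivAt_iff_tendsto_slope_zero.mp hderiv).mono_left
    (nhdsGT_le_nhdsNE (0 : ℝ))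
  refine ge_of_tendsto hlim ?_
  filter_upwards [Ioo_mem_nhdsGT (zero_lt_one (α := ℝ))] with r hr
  rw [zero_add, zero_smul, add_zero, smul_eq_mul]
  exact mul_nonneg (inv_nonneg.mpr hr.1.le)
    (sub_nonneg.mpr (hmin _ (hS.add_smul_sub_mem hX hY ⟨hr.1.le, hr.2.le⟩)))

end smooth

/-! ### Eigenprojections under an eigengap. -/

theorem Fin.filter_val_lt_eq_map_castLE {n m : ℕ} (h : m ≤ n) :
    (Finset.univ.filter fun i : Fin n => (i : ℕ) < m) = Finset.univ.map (Fin.castLEEmb h) := by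
  ext i
  simp only [Finset.mem_filter, Finset.mem_univ, true_and, Finset.mem_map]
  exact ⟨fun h => ⟨⟨i, h⟩, rfl⟩, fun ⟨j, hj⟩ => hj ▸ j.2⟩

theorem Fin.card_filter_val_lt_of_le {n m : ℕ} (h : m ≤ n) :
    (Finset.univ.filter fun i : Fin n => (i : ℕ) < m).card = m := by
  rw [Fin.filter_val_lt_eq_map_castLE h, Finset.card_map, Finset.card_univ, Fintype.card_fin]

theorem Fin.card_filter_le_val {n m : ℕ} (h : m ≤ n) :
    (Finset.univ.filter fun i : Fin n => m ≤ (i : ℕ)).card = n - m := by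
  have := Finset.card_filter_add_card_filter_not (s := (Finset.univ : Finset (Fin n)))
    (fun i => (i : ℕ) < m)
  rw [Fin.card_filter_val_lt_of_le h, Finset.card_univ, Fintype.card_fin] at this
  simp only [not_lt] at this
  omega

/-- The projection onto the `k` leading eigenvectors of a matrix with an eigengap. -/
theorem exists_top_projection {n k : ℕ} (hk : 1 ≤ k) (hkn : k < n) {W : Matrix (Fin n) (Fin n) ℝ}
    (hW : W ∈ symSpace n) {g : ℝ} (hg : 0 < g) (hgap : g ≤ nthEig W k - nthEig W (k + 1)) :
    ∃ P ∈ projMatrices n k, IsTopProjection k W P ∧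
      ∀ Z ∈ fantope n k, g * (k - (P * Z).trace) ≤ (W * (P - Z)).trace := by
  obtain ⟨U, hU, hWU⟩ := exists_spectral_decomposition hW
  let c : Fin k → Fin n := Fin.castLE hkn.le
  have hc : Function.Injective c := Fin.castLE_injective hkn.le
  set Q := U.submatrix id c with hQdef
  have hQ : Qᵀ * Q = 1 := by
    rw [hQdef, Matrix.transpose_submatrix, ← Matrix.submatrix_mul Uᵀ U c id c Function.bijective_id,
      hU, Matrix.submatrix_one c hc]
  have hWQ : W * Q = Q * Matrix.diagonal (fun i : Fin k => nthEig W ((i : ℕ) + 1)) := by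
    have h1 : W * U = U * Matrix.diagonal (fun i : Fin n => nthEig W ((i : ℕ) + 1)) := by
      conv_lhs => rw [hWU, Matrix.mul_assoc, hU, mul_one]
    ext i j
    have := congrFun (congrFun h1 i) (c j)
    rw [Matrix.mul_diagonal] at this ⊢
    exact this
  have hPQ : colProj U (Finset.univ.filter fun i : Fin n => (i : ℕ) < k) = Q * Qᵀ := by
    rw [Fin.filter_val_lt_eq_map_castLE hkn.le]
    ext i j
    rw [colProj, Matrix.mul_apply, Matrix.mul_apply]
    simp only [Matrix.mul_diagonal, mul_ite, mul_one, mul_zero, ite_mul, zero_mul,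
      Finset.sum_ite_mem, Finset.univ_inter, Finset.sum_map]
    rfl
  have hnonneg : ∀ Z ∈ fantope n k, 0 ≤ (k : ℝ) - (Q * Qᵀ * Z).trace := by
    intro Z hZ
    have := norm_sub_sq_le_of_mem_fantope (projMatrices_subset_fantope ⟨Q, hQ, rfl⟩) hZ
    nlinarith [sq_nonneg ‖Q * Qᵀ - Z‖]
  have hgapZ : ∀ Z ∈ fantope n k, g * (k - (Q * Qᵀ * Z).trace) ≤ (W * (Q * Qᵀ - Z)).trace := by
    intro Z hZ
    have := gap_mul_trace_le hU _
      (d := fun i : Fin n => nthEig W (i + 1)) (a := nthEig W k) (b := nthEig W (k + 1))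
      (fun i hi => ?_) (fun i hi => ?_) (Fin.card_filter_val_lt_of_le hkn.le) hZ
    · rw [← hWU, hPQ] at this
      exact (mul_le_mul_of_nonneg_right hgap (hnonneg Z hZ)).trans this
    · simp only [Finset.mem_filter, Finset.mem_univ, true_and] at hi
      exact nthEig_antitone hW (by omega) hi hkn.le
    · simp only [Finset.mem_filter, Finset.mem_univ, true_and, not_lt] at hi
      exact nthEig_antitone hW (by omega) (by omega) i.2
  have htr : ∀ R : Matrix (Fin n) (Fin k) ℝ, Rᵀ * R = 1 →
      W * R = R * Matrix.diagonal (fun i : Fin k => nthEig W ((i : ℕ) + 1)) →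
      (W * (R * Rᵀ)).trace = ∑ i : Fin k, nthEig W ((i : ℕ) + 1) := by
    intro R hR hWR
    rw [← Matrix.mul_assoc, hWR, Matrix.trace_mul_comm, ← Matrix.mul_assoc, hR, Matrix.one_mul,
      Matrix.trace_diagonal]
  refine ⟨Q * Qᵀ, ⟨Q, hQ, rfl⟩, fun R hR hWR => ?_, hgapZ⟩
  have hRF : R * Rᵀ ∈ fantope n k := projMatrices_subset_fantope ⟨R, hR, rfl⟩
  -- `R Rᵀ` and `Q Qᵀ` have the same trace against `W`, so the positive gap leaves no trace deficit.
  have h := hgapZ _ hRF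
  rw [Matrix.mul_sub, Matrix.trace_sub, htr Q hQ hWQ, htr R hR hWR, sub_self] at h
  have h1 := nonpos_of_mul_nonpos_right h hg
  have h2 := norm_sub_sq_le_of_mem_fantope (projMatrices_subset_fantope ⟨Q, hQ, rfl⟩) hRF
  exact sub_eq_zero.mp (norm_eq_zero.mp (pow_eq_zero_iff two_ne_zero |>.mp
    (le_antisymm (by linarith) (sq_nonneg _))))

/-- A Pythagorean inequality, by which `P` is the Euclidean projection of `W` onto the Fantope. -/
theorem norm_sub_sq_add_le {n k : ℕ} {W P Z : Matrix (Fin n) (Fin n) ℝ} (hW : W ∈ symSpace n)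
    (hP : P ∈ fantope n k) (hZ : Z ∈ fantope n k)
    (h : (k : ℝ) - (P * Z).trace ≤ (W * (P - Z)).trace) :
    ‖P - W‖ ^ 2 + ‖P - Z‖ ^ 2 ≤ ‖Z - W‖ ^ 2 := by
  -- Right side minus left side is `2 tr(W(P - Z)) - 2 tr(P²) + 2 tr(PZ)`, which `h` bounds below by
  -- `2(k - tr(P²))`.
  have hk := trace_sq_le_of_mem_fantope hP
  rw [frobenius_norm_sq_eq_trace (symSpace_sub hP.1.1 hW),
    frobenius_norm_sq_eq_trace (symSpace_sub hP.1.1 hZ.1.1),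
    frobenius_norm_sq_eq_trace (symSpace_sub hZ.1.1 hW)]
  simp only [Matrix.sub_mul, Matrix.mul_sub, Matrix.trace_sub] at h ⊢
  rw [Matrix.trace_mul_comm W P, Matrix.trace_mul_comm W Z] at *
  rw [Matrix.trace_mul_comm Z P]
  linarith

/-- An orthogonal diagonalization in which the `k` smallest eigenvalues are marked. -/
theorem exists_bottom_decomposition {n k : ℕ} (hk : 1 ≤ k) (hkn : k < n)
    {G : Matrix (Fin n) (Fin n) ℝ} (hG : G ∈ symSpace n) :
    ∃ (U : Matrix (Fin n) (Fin n) ℝ) (s : Finset (Fin n)) (d : Fin n → ℝ), Uᵀ * U = 1 ∧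
      s.card = k ∧ G = U * Matrix.diagonal d * Uᵀ ∧
      (∀ i ∈ s, d i ≤ nthEig G (n - k + 1)) ∧ ∀ i ∉ s, nthEig G (n - k) ≤ d i := by
  obtain ⟨U, hU, hGU⟩ := exists_spectral_decomposition hG
  refine ⟨U, Finset.univ.filter fun i : Fin n => n - k ≤ (i : ℕ), _, hU, ?_, hGU, ?_, ?_⟩
  · rw [Fin.card_filter_le_val (Nat.sub_le n k)]
    omega
  · intro i hi
    simp only [Finset.mem_filter, Finset.mem_univ, true_and] at hi
    exact nthEig_antitone hG (by omega) (by omega) i.2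
  · intro i hi
    simp only [Finset.mem_filter, Finset.mem_univ, true_and, not_le] at hi
    exact nthEig_antitone hG (by omega) hi (by omega)

/-- Stability of the eigengap of a gradient step at an extreme point of the Fantope. -/
theorem one_le_eigengap {n k : ℕ} (hk : 1 ≤ k) (hkn : k < n) {U : Matrix (Fin n) (Fin n) ℝ}
    (hU : Uᵀ * U = 1) {s : Finset (Fin n)} (hs : s.card = k) {d : Fin n → ℝ} {a b η : ℝ}
    (hη : 0 ≤ η) (ha : ∀ i ∈ s, d i ≤ a) (hb : ∀ i ∉ s, b ≤ d i) {W : Matrix (Fin n) (Fin n) ℝ}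
    (hW : W ∈ symSpace n)
    (hclose : ‖W - (colProj U s - η • (U * Matrix.diagonal d * Uᵀ))‖ ≤ η * (b - a) / 2) :
    1 ≤ nthEig W k - nthEig W (k + 1) := by
  obtain ⟨V, hV, hWV⟩ := exists_spectral_decomposition hW
  -- The eigenvalues of the unperturbed step: at least `1 - η a` on `s`, at most `-η b` off it, a
  -- gap of `1 + η (b - a)`.
  set e : Fin n → ℝ := fun i => (if i ∈ s then 1 else 0) - η * d i with he
  have hM : colProj U s - η • (U * Matrix.diagonal d * Uᵀ) = U * Matrix.diagonal e * Uᵀ := by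
    have : Matrix.diagonal e =
        Matrix.diagonal (fun i => if i ∈ s then (1 : ℝ) else 0) - η • Matrix.diagonal d := by
      rw [← Matrix.diagonal_smul, Matrix.diagonal_sub]
      rfl
    rw [this, colProj, Matrix.mul_sub, Matrix.sub_mul, Matrix.mul_smul, Matrix.smul_mul]
  have hes : ∀ i ∈ s, 1 - η * a ≤ e i := fun i hi => by
    simp only [he, hi, if_true]
    linarith [mul_le_mul_of_nonneg_left (ha i hi) hη]
  have hes' : ∀ i ∉ s, e i ≤ -(η * b) := fun i hi => by
    simp only [he, hi, if_false]
    linarith [mul_le_mul_of_nonneg_left (hb i hi) hη]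
  rw [hM] at hclose
  -- Weyl compares `k` against `k - 1` indices here and `k + 1` against `k` below; each use costs at
  -- most `η (b - a) / 2`.
  have h1 := le_add_norm_of_card_lt hU hV (μ := fun i : Fin n => nthEig W (i + 1))
    (r := Finset.univ.filter fun i : Fin n => (i : ℕ) < k - 1) (b := nthEig W k)
    (by rw [Fin.card_filter_val_lt_of_le (by omega), hs]; omega) hes (fun i hi => by
      simp only [Finset.mem_filter, Finset.mem_univ, true_and, not_lt] at hi
      exact nthEig_antitone hW hk (by omega) i.2)
  have h2 := le_add_norm_of_card_lt hV hU (d := fun i : Fin n => nthEig W (i + 1))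
    (s := Finset.univ.filter fun i : Fin n => (i : ℕ) < k + 1) (a := nthEig W (k + 1))
    (by rw [Fin.card_filter_val_lt_of_le (by omega), hs]; omega) (fun i hi => by
      simp only [Finset.mem_filter, Finset.mem_univ, true_and] at hi
      exact nthEig_antitone hW (by omega) (by omega) (by omega)) hes'
  rw [← hWV, norm_sub_rev] at h1
  rw [← hWV] at h2
  linarith

/-! ### One projected gradient step. -/

section step

variable {n k : ℕ} {f : Matrix (Fin n) (Fin n) ℝ → ℝ}
  {grad : Matrix (Fin n) (Fin n) ℝ → Matrix (Fin n) (Fin n) ℝ} {β : ℝ}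
  {X X' Z : Matrix (Fin n) (Fin n) ℝ}

/-- Completing the square: up to a constant, projecting the gradient step minimizes the quadratic
upper model of `f` at `X`. -/
theorem norm_sub_gradStep_sq (hβ : 0 < β) (hX : X ∈ symSpace n) (hG : grad X ∈ symSpace n)
    (hZ : Z ∈ symSpace n) :
    β / 2 * ‖Z - (X - (1 / β) • grad X)‖ ^ 2 =
      β / 2 * ‖Z - X‖ ^ 2 + (grad X * (Z - X)).trace + 1 / (2 * β) * ‖grad X‖ ^ 2 := by
  rw [frobenius_norm_sq_eq_trace
    (symSpace_sub hZ (symSpace_sub hX (symSpace_smul _ hG))),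
    frobenius_norm_sq_eq_trace (symSpace_sub hZ hX), frobenius_norm_sq_eq_trace hG]
  have : Z - (X - (1 / β) • grad X) = (Z - X) + (1 / β) • grad X := by abel
  rw [this]
  simp only [Matrix.add_mul, Matrix.mul_add, Matrix.trace_add, Matrix.smul_mul, Matrix.mul_smul,
    Matrix.trace_smul, smul_eq_mul]
  rw [Matrix.trace_mul_comm (Z - X) (grad X)]
  field_simp
  ring

/-- The iterates of projected gradient descent do not move away from a minimizer. -/
theorem norm_sub_le_of_gradStep {Y : Matrix (Fin n) (Fin n) ℝ} (hβ : 0 < β)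
    (hf : IsConvexSmooth f grad β) (hX : X ∈ symSpace n) (hX' : X' ∈ symSpace n)
    (hY : Y ∈ symSpace n) (hmin : f Y ≤ f X')
    (hpyth : ‖X' - (X - (1 / β) • grad X)‖ ^ 2 + ‖X' - Y‖ ^ 2 ≤ ‖Y - (X - (1 / β) • grad X)‖ ^ 2) :
    ‖X' - Y‖ ≤ ‖X - Y‖ := by
  have hG := (hf.gradient X hX).1
  have h1 := norm_sub_gradStep_sq hβ hX hG hX'
  have h2 := norm_sub_gradStep_sq hβ hX hG hY
  -- Descent bounds the model at `X'` below by `f X'`, convexity bounds its linear part at `Y` above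
  -- by `f Y`, and `f Y ≤ f X'` leaves only the distances.
  have h3 := hf.descent hX hX'
  have h4 := hf.le_of_convex hX hY
  have h5 := mul_le_mul_of_nonneg_left hpyth (half_pos hβ).le
  rw [norm_sub_rev Y X] at h2
  refine (sq_le_sq₀ (norm_nonneg _) (norm_nonneg _)).mp ?_
  refine le_of_mul_le_mul_left ?_ (half_pos hβ)
  linarith

/-- Linear decrease of the function value under quadratic growth. -/
theorem sub_le_of_gradStep {S : Set (Matrix (Fin n) (Fin n) ℝ)} {Y : Matrix (Fin n) (Fin n) ℝ}
    {δ : ℝ} (hβ : 0 < β) (hδ : 0 < δ) (hf : IsConvexSmooth f grad β) (hS : Convex ℝ S)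
    (hSs : S ⊆ symSpace n) (hX : X ∈ S) (hY : Y ∈ S)
    (hX' : IsEuclProj S (X - (1 / β) • grad X) X')
    (hgrowth : δ / 2 * ‖X - Y‖ ^ 2 ≤ f X - f Y) :
    f X' - f Y ≤ (f X - f Y) * Real.exp (-(1 / 4 * min (δ / β) 1)) := by
  have hG := (hf.gradient X (hSs hX)).1
  set m := min (δ / β) 1 with hm
  have hm0 : 0 < m := lt_min (div_pos hδ hβ) one_pos
  have hm1 : m ≤ 1 := min_le_right _ _
  have hmβ : m * β ≤ δ := by
    have := mul_le_mul_of_nonneg_right (min_le_left (δ / β) 1) hβ.le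
    rwa [div_mul_cancel₀ _ hβ.ne'] at this
  -- A test point for the model: moving by `m/2` towards `Y` gains `m/2` of the value gap, and by
  -- growth its quadratic term costs at most `m/4`.
  have hZ : X + (m / 2) • (Y - X) ∈ S := hS.add_smul_sub_mem hX hY ⟨by linarith, by linarith⟩
  have h0 := (sq_le_sq₀ (norm_nonneg _) (norm_nonneg _)).mpr (hX'.2 _ hZ)
  have h1 := norm_sub_gradStep_sq hβ (hSs hX) hG (hSs hX'.1)
  have h2 := norm_sub_gradStep_sq hβ (hSs hX) hG (hSs hZ)
  have h3 := hf.descent (hSs hX) (hSs hX'.1)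
  have h4 := hf.le_of_convex (hSs hX) (hSs hY)
  have h5 := mul_le_mul_of_nonneg_left h0 (half_pos hβ).le
  rw [add_sub_cancel_left, Matrix.mul_smul, Matrix.trace_smul, smul_eq_mul, norm_smul, mul_pow,
    norm_sub_rev Y X, Real.norm_of_nonneg (by linarith)] at h2
  have h6 : β * m * ‖X - Y‖ ^ 2 ≤ 2 * (f X - f Y) := by
    have := mul_le_mul_of_nonneg_right hmβ (sq_nonneg ‖X - Y‖)
    linarith
  have h7 := mul_le_mul_of_nonneg_left h6 hm0.le
  have h8 := mul_le_mul_of_nonneg_left h4 hm0.le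
  have h9 : f X' - f Y ≤ (f X - f Y) * (1 - 1 / 4 * m) := by nlinarith
  have h10 : 0 ≤ f X - f Y := le_trans (by positivity) hgrowth
  refine h9.trans (mul_le_mul_of_nonneg_left ?_ h10)
  linarith [Real.add_one_le_exp (-(1 / 4 * m))]

end step

/-! ### Assembly of the theorem. -/

theorem theorem4 :
    ∃ c : ℝ, 0 < c ∧
      ∀ (n k : ℕ), 1 ≤ k → k < n →
      ∀ (f : Matrix (Fin n) (Fin n) ℝ → ℝ)
        (grad : Matrix (Fin n) (Fin n) ℝ → Matrix (Fin n) (Fin n) ℝ) (β δ : ℝ),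
        0 < β → 0 < δ → IsConvexSmooth f grad β →
      ∀ Xstar : Matrix (Fin n) (Fin n) ℝ,
        -- an optimal solution over the Fantope, with an eigengap of at least δ
        Xstar ∈ fantope n k → (∀ Z ∈ fantope n k, f Xstar ≤ f Z) →
        δ ≤ nthEig (grad Xstar) (n - k) - nthEig (grad Xstar) (n - k + 1) →
      ∀ X : ℕ → Matrix (Fin n) (Fin n) ℝ,
        X 1 ∈ fantope n k → ‖X 1 - Xstar‖ ≤ δ / (4 * β) →
        IsPGD (projMatrices n k) grad (1 / β) X →
      ∀ t : ℕ, 1 ≤ t →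
        -- rank k, and the step is the (unique) projected gradient step over the Fantope, the only
        -- possible step over the rank-k projections, and computable from the top k eigenvectors
        (X (t + 1)).rank = k ∧
        (∀ Y, IsEuclProj (fantope n k) (X t - (1 / β) • grad (X t)) Y ↔ Y = X (t + 1)) ∧
        (∀ Y, IsEuclProj (projMatrices n k) (X t - (1 / β) • grad (X t)) Y ↔ Y = X (t + 1)) ∧
        IsTopProjection k (X t - (1 / β) • grad (X t)) (X (t + 1)) ∧
        -- linear convergence
        f (X t) - f Xstar ≤
          (f (X 1) - f Xstar) * Real.exp (-(c * min (δ / β) 1) * ((t : ℝ) - 1)) := by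
  refine ⟨1 / 4, by norm_num, ?_⟩
  intro n k hk hkn f grad β δ hβ hδ hf Xstar hXs hmin hgap X hX1 hX1d hpgd
  have hsym : fantope n k ⊆ symSpace n := fantope_subset_symSpace
  have hGs := (hf.gradient Xstar (hsym hXs)).1
  obtain ⟨U, s, d, hU, hs, hGU, hds, hds'⟩ := exists_bottom_decomposition hk hkn hGs
  have hPF := colProj_mem_fantope hU s hs
  have hbottom : ∀ Z ∈ fantope n k,
      δ / 2 * ‖colProj U s - Z‖ ^ 2 ≤ (grad Xstar * (Z - colProj U s)).trace := by
    intro Z hZ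
    -- Negating `d` turns the `k` smallest eigenvalues into the `k` largest.
    have h1 := gap_mul_trace_le hU s (d := -d) (fun i hi => neg_le_neg (hds i hi))
      (fun i hi => neg_le_neg (hds' i hi)) hs hZ
    have h2 := norm_sub_sq_le_of_mem_fantope hPF hZ
    rw [show Matrix.diagonal (-d) = -Matrix.diagonal d from (Matrix.diagonal_neg d).symm,
      Matrix.mul_neg, Matrix.neg_mul, ← hGU, Matrix.neg_mul,
      ← Matrix.mul_neg, neg_sub] at h1
    nlinarith [sq_nonneg ‖colProj U s - Z‖]
  -- First-order optimality at `Xstar` and the strict growth in `hbottom` have opposite signs unless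
  -- the two points agree.
  have hXP : colProj U s = Xstar := by
    have h1 := hf.trace_grad_mul_nonneg convex_fantope hsym hXs hmin hPF
    have h2 := hbottom Xstar hXs
    rw [← neg_sub (colProj U s) Xstar, Matrix.mul_neg, Matrix.trace_neg] at h2
    have h3 : ‖colProj U s - Xstar‖ ^ 2 ≤ 0 := by
      by_contra hlt
      nlinarith
    exact sub_eq_zero.mp (norm_eq_zero.mp (pow_eq_zero_iff two_ne_zero |>.mp
      (le_antisymm h3 (sq_nonneg _))))
  have hgrowth : ∀ Z ∈ fantope n k, δ / 2 * ‖Z - Xstar‖ ^ 2 ≤ f Z - f Xstar := by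
    intro Z hZ
    have h1 := hbottom Z hZ
    have h2 := hf.le_of_convex (hsym hXs) (hsym hZ)
    rw [hXP, norm_sub_rev] at h1
    linarith
  have hstep : ∀ t, 1 ≤ t → X t ∈ fantope n k → ‖X t - Xstar‖ ≤ δ / (4 * β) →
      IsTopProjection k (X t - (1 / β) • grad (X t)) (X (t + 1)) ∧
      ∀ Z ∈ fantope n k, ‖X (t + 1) - (X t - (1 / β) • grad (X t))‖ ^ 2 + ‖X (t + 1) - Z‖ ^ 2 ≤
        ‖Z - (X t - (1 / β) • grad (X t))‖ ^ 2 := by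
    intro t ht htF htd
    have hW : X t - (1 / β) • grad (X t) ∈ symSpace n :=
      symSpace_sub (hsym htF) (symSpace_smul _ (hf.gradient _ (hsym htF)).1)
    have hη : (0 : ℝ) ≤ 1 / β := by positivity
    have hWgap := one_le_eigengap hk hkn hU hs hη hds hds' hW (by
      rw [← hGU, hXP]
      have h1 := hf.lipschitz _ (hsym htF) _ (hsym hXs)
      have h2 : X t - (1 / β) • grad (X t) - (Xstar - (1 / β) • grad Xstar) =
          (X t - Xstar) - (1 / β) • (grad (X t) - grad Xstar) := by module
      have h3 := norm_sub_le (X t - Xstar) ((1 / β) • (grad (X t) - grad Xstar))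
      rw [norm_smul, Real.norm_of_nonneg hη] at h3
      rw [h2]
      have h4 := mul_le_mul_of_nonneg_left h1 hη
      rw [← mul_assoc, one_div_mul_cancel hβ.ne', one_mul] at h4
      have h5 : δ / (4 * β) = 1 / β * δ / 4 := by field_simp
      have h6 := mul_le_mul_of_nonneg_left hgap hη
      linarith)
    obtain ⟨P, hP, htop, hPgap⟩ := exists_top_projection hk hkn hW one_pos hWgap
    have hpyth : ∀ Z ∈ fantope n k, ‖P - (X t - (1 / β) • grad (X t))‖ ^ 2 + ‖P - Z‖ ^ 2 ≤
        ‖Z - (X t - (1 / β) • grad (X t))‖ ^ 2 := fun Z hZ =>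
      norm_sub_sq_add_le hW (projMatrices_subset_fantope hP) hZ (by simpa using hPgap Z hZ)
    -- The chosen point is no farther from `W_t` than `P`, and Pythagoras leaves no room for a
    -- second such point.
    have hPX : P = X (t + 1) := by
      have h1 := hpyth _ (projMatrices_subset_fantope (hpgd t ht).1)
      have h2 := (sq_le_sq₀ (norm_nonneg _) (norm_nonneg _)).mpr ((hpgd t ht).2 P hP)
      exact sub_eq_zero.mp (norm_eq_zero.mp (pow_eq_zero_iff two_ne_zero |>.mp
        (le_antisymm (by linarith) (sq_nonneg _))))
    exact hPX ▸ ⟨htop, hpyth⟩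
  have hinv : ∀ t, 1 ≤ t → X t ∈ fantope n k ∧ ‖X t - Xstar‖ ≤ δ / (4 * β) := by
    intro t ht
    induction t, ht using Nat.le_induction with
    | base => exact ⟨hX1, hX1d⟩
    | succ t ht ih =>
      have hF := projMatrices_subset_fantope (hpgd t ht).1
      exact ⟨hF, (norm_sub_le_of_gradStep hβ hf (hsym ih.1) (hsym hF) (hsym hXs) (hmin _ hF)
        ((hstep t ht ih.1 ih.2).2 _ hXs)).trans ih.2⟩
  have hunique : ∀ t, 1 ≤ t → ∀ S ⊆ fantope n k, X (t + 1) ∈ S → ∀ Y,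
      IsEuclProj S (X t - (1 / β) • grad (X t)) Y ↔ Y = X (t + 1) := by
    intro t ht S hS hXS Y
    have hpyth := (hstep t ht (hinv t ht).1 (hinv t ht).2).2
    constructor
    · rintro ⟨hYS, hY⟩
      have h1 := hpyth _ (hS hYS)
      have h2 := (sq_le_sq₀ (norm_nonneg _) (norm_nonneg _)).mpr (hY _ hXS)
      exact (sub_eq_zero.mp (norm_eq_zero.mp (pow_eq_zero_iff two_ne_zero |>.mp
        (le_antisymm (by linarith) (sq_nonneg _))))).symm
    · rintro rfl
      refine ⟨hXS, fun Z hZ => (sq_le_sq₀ (norm_nonneg _) (norm_nonneg _)).mp ?_⟩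
      linarith [hpyth Z (hS hZ), sq_nonneg ‖X (t + 1) - Z‖]
  have hproj : ∀ t, 1 ≤ t → IsEuclProj (fantope n k) (X t - (1 / β) • grad (X t)) (X (t + 1)) :=
    fun t ht => (hunique t ht _ subset_rfl (hinv (t + 1) (by omega)).1 _).mpr rfl
  intro t ht
  refine ⟨rank_of_mem_projMatrices (hpgd t ht).1,
    hunique t ht _ subset_rfl (hinv (t + 1) (by omega)).1,
    hunique t ht _ projMatrices_subset_fantope (hpgd t ht).1,
    (hstep t ht (hinv t ht).1 (hinv t ht).2).1, ?_⟩
  induction t, ht using Nat.le_induction with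
  | base => simp
  | succ t ht ih =>
    have h := sub_le_of_gradStep hβ hδ hf convex_fantope hsym (hinv t ht).1 hXs (hproj t ht)
      (hgrowth _ (hinv t ht).1)
    refine h.trans ((mul_le_mul_of_nonneg_right ih (Real.exp_nonneg _)).trans (le_of_eq ?_))
    rw [mul_assoc, ← Real.exp_add]
    congr 2
    push_cast
    ring
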